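/- **Theorem (Stability of the BDF-2-EEV scheme).** Let $\mathcal D\subset\mathbb R^d$, $d\in\{2,3\}$, be a convex polygonal or polyhedral domain, $\boldsymbol X=\boldsymbol H^1_0(\mathcal D)$ and $Q=L^2_0(\mathcal D)$. Write $(\cdot,\cdot)$, $\|\cdot\|$ for the $L^2(\mathcal D)$ inner product and norm, $\|\boldsymbol g\|_{-1}=\sup_{\boldsymbol v\in\boldsymbol X\setminus\{0\}}|\langle \boldsymbol g,\boldsymbol v\rangle|/\|\nabla\boldsymbol v\|$ for $\boldsymbol g\in\boldsymbol H^{-1}(\mathcal D)=\boldsymbol X^*$, and $b^*(\boldsymbol u,\boldsymbol v,\boldsymbol w)=\tfrac12(\boldsymbol u\cdot\nabla\boldsymbol v,\boldsymbol w)-\tfrac12(\boldsymbol u\cdot\nabla\boldsymbol w,\boldsymbol v)$. There is a constant $C>0$ depending only on $\mathcal D$ such that the following holds. Let $\boldsymbol X_h\subset\boldsymbol X$ and $Q_h\subset Q$ be conforming finite element spaces: they are finite-dimensional, and on each cell of some finite mesh of $\mathcal D$ (pairwise disjoint open cells covering $\mathcal D$ up to a null set) every $\boldsymbol v_h\in\boldsymbol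 X_h$ is the restriction of a $C^1$ function on $\mathbb R^d$, e.g. of a polynomial. Let $J\ge1$, and for $1\le j\le J$ let $\nu_j\in L^\infty(\mathcal D)$ be bounded below by a positive constant and let $\boldsymbol f_j$ be a function of time with values in $\boldsymbol H^{-1}(\mathcal D)$. Put $\bar\nu=\frac1J\sum_{j}\nu_j$, $\nu_j'=\nu_j-\bar\nu$, $\bar\nu_{\min}=\operatorname{ess\,inf}_{\mathcal D}\bar\nu$, $\tilde\alpha_j=\bar\nu_{\min}-3\|\nu_j'\|_\infty$, and assume $\tilde\alpha_j>0$ for all $j$. Let $\gamma>0$, $\mu\ge1$, $T>0$, $\Delta t>0$ with $M=T/\Delta t$ an integer, and $t_n=n\Delta t$. Let $\boldsymbol u_{j,h}^0,\boldsymbol u_{j,h}^1\in\boldsymbol X$, and for $n=1,\dots,M-1$ let $(\boldsymbol u_{j,h}^{n+1},p_{j,h}^{n+1})\in\boldsymbol X_h\times Q_h$, $1\le j\le J$, solve the linearized BDF-2 ensemble eddy viscosity scheme: for all $(\boldsymbol\chi_h,q_h)\in\boldsymbol X_h\times Q_h$, $(\nabla\cdot\boldsymbol u_{j,h}^{n+1},q_h)=0$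 and \begin{align*} &\tfrac{3}{2\Delta t}(\boldsymbol u_{j,h}^{n+1},\boldsymbol\chi_h)+b^*(\langle\boldsymbol u_h\rangle^n,\boldsymbol u_{j,h}^{n+1},\boldsymbol\chi_h)+(\bar\nu\nabla\boldsymbol u_{j,h}^{n+1},\nabla\boldsymbol\chi_h)+(\gamma\nabla\cdot\boldsymbol u_{j,h}^{n+1}-p_{j,h}^{n+1},\nabla\cdot\boldsymbol\chi_h)+(2\nu_T^h\nabla\boldsymbol u_{j,h}^{n+1},\nabla\boldsymbol\chi_h)\\ &=\langle\boldsymbol f_j(t_{n+1}),\boldsymbol\chi_h\rangle+\tfrac{2}{\Delta t}(\boldsymbol u_{j,h}^{n},\boldsymbol\chi_h)-\tfrac1{2\Delta t}(\boldsymbol u_{j,h}^{n-1},\boldsymbol\chi_h)-b^*(\boldsymbol u_{j,h}'^{\,n},\boldsymbol{\mathcal U}_{j,h}^n,\boldsymbol\chi_h)-(\nu_j'\nabla\boldsymbol{\mathcal U}_{j,h}^n,\nabla\boldsymbol\chi_h), \end{align*} where, for $1\le n\le M$, $\boldsymbol{\mathcal U}_{j,h}^n=2\boldsymbol u_{j,h}^n-\boldsymbol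 u_{j,h}^{n-1}$, $\langle\boldsymbol u_h\rangle^n=\frac1J\sum_{j}\boldsymbol{\mathcal U}_{j,h}^n$, $\boldsymbol u_{j,h}'^{\,n}=\boldsymbol{\mathcal U}_{j,h}^n-\langle\boldsymbol u_h\rangle^n$ and $\nu_T^h=\mu\Delta t\sum_{j}|\boldsymbol u_{j,h}'^{\,n}|^2$. If $$\Delta t\,\|\nabla\cdot\boldsymbol u_{j,h}'^{\,n}\|_{L^\infty}^2\le C\tilde\alpha_j\qquad(1\le j\le J,\ 1\le n\le M)$$ (where the left side is $+\infty$ if $\nabla\cdot\boldsymbol u_{j,h}'^{\,n}\notin L^\infty$), then for every $j$ \begin{align*} &\|\boldsymbol u_{j,h}^M\|^2+\|2\boldsymbol u_{j,h}^M-\boldsymbol u_{j,h}^{M-1}\|^2+2\tilde\alpha_j\Delta t\sum_{n=2}^M\|\nabla\boldsymbol u_{j,h}^n\|^2+4\gamma\Delta t\sum_{n=2}^M\|\nabla\cdot\boldsymbol u_{j,h}^n\|^2\\ &\le\|\boldsymbol u_{j,h}^1\|^2+\|2\boldsymbol u_{j,h}^1-\boldsymbol u_{j,h}^0\|^2+2\bar\nu_{\min}\Delta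 t\|\nabla\boldsymbol u_{j,h}^1\|^2+2\Delta t\left(\bar\nu_{\min}-2\|\nu_j'\|_\infty\right)\|\nabla\boldsymbol u_{j,h}^0\|^2+\frac{4\Delta t}{\tilde\alpha_j}\sum_{n=2}^M\|\boldsymbol f_j(t_n)\|_{-1}^2. \end{align*} -/

import Mathlib

open MeasureTheory Filter Topology
open scoped ENNReal ContDiff

namespace BDF2EEV

noncomputable section

/-- Physical space `ℝ^d` with the Euclidean norm. -/
abbrev E (d : ℕ) : Type := EuclideanSpace ℝ (Fin d)

/-- `d × d` matrices with the Frobenius norm and inner product; the entry `(i, k)` of a gradient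
is the derivative of the `i`-th component in the direction `k`. -/
abbrev Mat (d : ℕ) : Type := EuclideanSpace ℝ (Fin d × Fin d)

/-- Lebesgue measure on the domain `D`. -/
abbrev vol {d : ℕ} (D : Set (E d)) : Measure (E d) := volume.restrict D

/-- A convex polygonal (`d = 2`) or polyhedral (`d = 3`) domain: the nonempty interior of the
convex hull of finitely many points. -/
def IsConvexPolytopalDomain {d : ℕ} (D : Set (E d)) : Prop :=
  D.Nonempty ∧ ∃ s : Finset (E d), D = interior (convexHull ℝ (s : Set (E d)))

/-- The classical gradient of a differentiable vector field. -/
def classicalGrad {d : ℕ} (φ : E d → E d) (x : E d) : Mat d :=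
  WithLp.toLp 2 fun ik => fderiv ℝ φ x (EuclideanSpace.single ik.2 1) ik.1

/-- The pairs `(φ, ∇φ)` in `L²(D)^d × L²(D)^{d×d}`, `φ` smooth with compact support in `D`. -/
def testPairs {d : ℕ} (D : Set (E d)) :
    Submodule ℝ (Lp (E d) 2 (vol D) × Lp (Mat d) 2 (vol D)) where
  carrier := {w | ∃ φ : E d → E d, ContDiff ℝ ∞ φ ∧ HasCompactSupport φ ∧ tsupport φ ⊆ D ∧
    w.1 =ᵐ[vol D] φ ∧ w.2 =ᵐ[vol D] classicalGrad φ}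
  zero_mem' := by
    refine ⟨0, contDiff_const, HasCompactSupport.zero, by simp [tsupport], ?_, ?_⟩
    · exact Lp.coeFn_zero _ _ _
    · have h0 : classicalGrad (0 : E d → E d) = 0 := by
        funext x; ext ik; simp [classicalGrad]
      rw [h0]; exact Lp.coeFn_zero _ _ _
  add_mem' := by
    rintro a b ⟨φ, h1, h2, h3, h4, h5⟩ ⟨ψ, k1, k2, k3, k4, k5⟩
    refine ⟨φ + ψ, h1.add k1, h2.add k2, ?_, ?_, ?_⟩
    · exact (tsupport_add φ ψ).trans (Set.union_subset h3 k3)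
    · exact (Lp.coeFn_add a.1 b.1).trans (h4.add k4)
    · refine (Lp.coeFn_add a.2 b.2).trans ((h5.add k5).trans (Eventually.of_forall fun x => ?_))
      have e := fderiv_add (h1.differentiable (by simp) x) (k1.differentiable (by simp) x)
      ext ik
      simp [classicalGrad, e]
  smul_mem' := by
    rintro c a ⟨φ, h1, h2, h3, h4, h5⟩
    refine ⟨c • φ, contDiff_const.smul h1, ?_, ?_, ?_, ?_⟩
    · exact h2.smul_left (f := fun _ => c)
    · exact (tsupport_smul_subset_right (fun _ => c) φ).trans h3
    · exact (Lp.coeFn_smul c a.1).trans (h4.const_smul c)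
    · refine (Lp.coeFn_smul c a.2).trans ((h5.const_smul c).trans
        (Eventually.of_forall fun x => ?_))
      have e := fderiv_const_smul (h1.differentiable (by simp) x) c
      ext ik
      simp [classicalGrad, e]

/-- The velocity space `X = H¹₀(D)^d`: the closure of the smooth compactly supported vector fields
in the `H¹` norm. An element `v` is stored as the pair of the `L²` classes of `v` and of its weak
gradient (the second component is determined by the first). -/
def H10 {d : ℕ} (D : Set (E d)) :
    Submodule ℝ (Lp (E d) 2 (vol D) × Lp (Mat d) 2 (vol D)) :=
  (testPairs D).topologicalClosure

variable {d : ℕ} {D : Set (E d)}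

/-- The underlying `L²` vector field of an element of `H¹₀`. -/
def val (v : H10 D) : Lp (E d) 2 (vol D) := v.1.1

/-- The weak gradient. -/
def grad (v : H10 D) : Lp (Mat d) 2 (vol D) := v.1.2

/-- The trace of a matrix as a continuous linear functional. -/
def trace (d : ℕ) : Mat d →L[ℝ] ℝ := ∑ i : Fin d, EuclideanSpace.proj (i, i)

/-- The weak divergence, the trace of the weak gradient, as an element of `L²(D)`. -/
def dvg (v : H10 D) : Lp ℝ 2 (vol D) := (trace d).compLp (grad v)

/-- `H⁻¹(D)^d`, the dual space of `H¹₀(D)^d`. -/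
abbrev HMinus {d : ℕ} (D : Set (E d)) : Type := StrongDual ℝ (H10 D)

/-- The `H⁻¹` norm `‖f‖₋₁ = sup_v |⟨f, v⟩| / ‖∇v‖`. -/
def normHMinus (f : HMinus D) : ℝ := ⨆ v : H10 D, |f v| / ‖grad v‖

/-- The convective term `(u · ∇v, w)`. -/
def conv (u v w : H10 D) : ℝ :=
  ∫ x, ∑ i : Fin d, ∑ k : Fin d, val u x k * grad v x (i, k) * val w x i ∂(vol D)

/-- The skew-symmetric trilinear form `b*(u, v, w) = ½ (u · ∇v, w) - ½ (u · ∇w, v)`. -/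
def bStar (u v w : H10 D) : ℝ := 1 / 2 * conv u v w - 1 / 2 * conv u w v

/-- The weighted product `(a ∇v, ∇w)` for a scalar coefficient `a`. -/
def wGrad (a : E d → ℝ) (v w : H10 D) : ℝ :=
  ∫ x, a x * inner ℝ (grad v x) (grad w x) ∂(vol D)

/-- A finite mesh of `D`: pairwise disjoint open cells that cover `D` up to a null set. -/
structure IsMesh (D : Set (E d)) (cells : Finset (Set (E d))) : Prop where
  isOpen : ∀ K ∈ cells, IsOpen K
  subset : ∀ K ∈ cells, K ⊆ D
  disjoint : ∀ K ∈ cells, ∀ K' ∈ cells, K ≠ K' → Disjoint K K'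
  cover : volume (D \ ⋃ K ∈ cells, K) = 0

/-- A pair of conforming finite element spaces `X_h ⊆ H¹₀(D)^d`, `Q_h ⊆ L²₀(D)`: finite-dimensional
spaces, the velocities being given on each cell of a mesh by functions that are continuously
differentiable up to the boundary of the cell (for instance by polynomials). -/
structure FEPair (D : Set (E d)) where
  cells : Finset (Set (E d))
  isMesh : IsMesh D cells
  Xh : Submodule ℝ (H10 D)
  Qh : Submodule ℝ (Lp ℝ 2 (vol D))
  finiteDimensional_Xh : FiniteDimensional ℝ Xh
  finiteDimensional_Qh : FiniteDimensional ℝ Qh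
  piecewise : ∀ v ∈ Xh, ∀ K ∈ cells, ∃ g : E d → E d, ContDiff ℝ 1 g ∧ val v =ᵐ[volume.restrict K] g
  mean_zero : ∀ q ∈ Qh, ∫ x, q x ∂(vol D) = 0

/-- The mean viscosity `ν̄ = (1/J) ∑ ν_j`. -/
def nuBar {J : ℕ} (ν : Fin J → E d → ℝ) (x : E d) : ℝ := 1 / (J : ℝ) * ∑ j, ν j x

/-- The viscosity fluctuation `ν'_j = ν_j - ν̄`. -/
def nuPrime {J : ℕ} (ν : Fin J → E d → ℝ) (j : Fin J) (x : E d) : ℝ := ν j x - nuBar ν x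

/-- `ν̄_min`, the (essential) minimum of the mean viscosity over `D`. -/
def nuBarMin (D : Set (E d)) {J : ℕ} (ν : Fin J → E d → ℝ) : ℝ := essInf (nuBar ν) (vol D)

/-- `‖ν'_j‖_∞`, the norm in `L^∞(D)`. -/
def nuPrimeSup (D : Set (E d)) {J : ℕ} (ν : Fin J → E d → ℝ) (j : Fin J) : ℝ :=
  (eLpNorm (nuPrime ν j) ∞ (vol D)).toReal

/-- `α̃_j = ν̄_min - 3 ‖ν'_j‖_∞`. -/
def alphaTilde (D : Set (E d)) {J : ℕ} (ν : Fin J → E d → ℝ) (j : Fin J) : ℝ :=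
  nuBarMin D ν - 3 * nuPrimeSup D ν j

/-- The extrapolated velocity `𝓤_j^n = 2 u_j^n - u_j^{n-1}`, used for `n ≥ 1`. -/
def extrap {J : ℕ} (u : Fin J → ℕ → H10 D) (j : Fin J) (n : ℕ) : H10 D :=
  (2 : ℝ) • u j n - u j (n - 1)

/-- The ensemble mean `<u_h>^n = (1/J) ∑ 𝓤_j^n`. -/
def ensembleMean {J : ℕ} (u : Fin J → ℕ → H10 D) (n : ℕ) : H10 D :=
  (1 / (J : ℝ)) • ∑ j, extrap u j n

/-- The velocity fluctuation `u'_j^n = 2 u_j^n - u_j^{n-1} - <u_h>^n`. -/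
def fluct {J : ℕ} (u : Fin J → ℕ → H10 D) (j : Fin J) (n : ℕ) : H10 D :=
  extrap u j n - ensembleMean u n

/-- The mixing length `l_h^n = √(∑_j |u'_j^n|²)`. -/
def mixingLength {J : ℕ} (u : Fin J → ℕ → H10 D) (n : ℕ) (x : E d) : ℝ :=
  Real.sqrt (∑ j, ‖val (fluct u j n) x‖ ^ 2)

/-- The discrete ensemble eddy viscosity `ν_T^h = μ Δt (l_h^n)²`. -/
def eddyViscosity {J : ℕ} (μ Δt : ℝ) (u : Fin J → ℕ → H10 D) (n : ℕ) (x : E d) : ℝ :=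
  μ * Δt * mixingLength u n x ^ 2

/-- `(u, p)` is a solution, up to the time level `M`, of the linearized BDF-2-EEV scheme with
starting values `u_j^0`, `u_j^1`. The source is `f_j(t_{n+1}) + (2/Δt) u_j^n - (1/(2Δt)) u_j^{n-1}`
with `t_n = n Δt`. -/
structure IsBDF2EEVSolution {J : ℕ} (S : FEPair D) (ν : Fin J → E d → ℝ)
    (f : Fin J → ℝ → HMinus D) (γ μ Δt : ℝ) (M : ℕ)
    (u : Fin J → ℕ → H10 D) (p : Fin J → ℕ → Lp ℝ 2 (vol D)) : Prop where
  velocity_mem : ∀ j n, 1 ≤ n → n + 1 ≤ M → u j (n + 1) ∈ S.Xh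
  pressure_mem : ∀ j n, 1 ≤ n → n + 1 ≤ M → p j (n + 1) ∈ S.Qh
  momentum : ∀ j n, 1 ≤ n → n + 1 ≤ M → ∀ χ ∈ S.Xh,
    (3 / 2) / Δt * inner ℝ (val (u j (n + 1))) (val χ)
        + bStar (ensembleMean u n) (u j (n + 1)) χ
        + wGrad (nuBar ν) (u j (n + 1)) χ
        + inner ℝ (γ • dvg (u j (n + 1)) - p j (n + 1)) (dvg χ)
        + wGrad (fun x => 2 * eddyViscosity μ Δt u n x) (u j (n + 1)) χ
      = f j (((n + 1 : ℕ) : ℝ) * Δt) χ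
        + 2 / Δt * inner ℝ (val (u j n)) (val χ)
        - 1 / (2 * Δt) * inner ℝ (val (u j (n - 1))) (val χ)
        - bStar (fluct u j n) (extrap u j n) χ
        - wGrad (nuPrime ν j) (extrap u j n) χ
  incompressibility : ∀ j n, 1 ≤ n → n + 1 ≤ M → ∀ q ∈ S.Qh,
    inner ℝ (dvg (u j (n + 1))) q = 0

/-- The time-step restriction `Δt ≤ C α̃_j / ‖∇·u'_j^n‖²_{L^∞}` for all `j` and `1 ≤ n ≤ M`, written
without division: it is void where `∇·u'_j^n = 0` and fails where `∇·u'_j^n` is unbounded. -/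
def TimeStepCondition {J : ℕ} (C : ℝ) (ν : Fin J → E d → ℝ) (Δt : ℝ) (M : ℕ)
    (u : Fin J → ℕ → H10 D) : Prop :=
  ∀ j n, 1 ≤ n → n ≤ M →
    ENNReal.ofReal Δt * eLpNorm (dvg (fluct u j n)) ∞ (vol D) ^ 2
      ≤ ENNReal.ofReal (C * alphaTilde D ν j)

end

end BDF2EEV

/-!
The scheme is tested with `χ = v := u_j^{n+1}`. With the increment
`δ = u_j^{n+1} - 2 u_j^n + u_j^{n-1} = v - 𝓤_j^n`, the BDF-2 difference quotient produces the change
of the energy `‖u_j^n‖² + ‖2 u_j^n - u_j^{n-1}‖²` divided by `4 Δt`, plus the numerical dissipation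
`‖δ‖² / (4 Δt)` (`bdf2_identity`). The pressure drops out because `∇ · v` is orthogonal to `Q_h`,
and the convection by the ensemble mean because `b*` is skew-symmetric.

The term to control is `b*(u', 𝓤, v)`. By skew-symmetry it equals `b*(u', v, δ)`
(`bStar_eq_bStar_sub`), and an integration by parts turns it into
`(u' · ∇v, δ) + ½ ((∇ · u') v, δ)` (`bStar_eq`). Young's inequality (`abs_bStar_le`) bounds it by
`2 Δt ∫ |u'|² |∇v|²`, which the eddy viscosity absorbs since `μ ≥ 1` (`le_wGrad_eddyViscosity`), by
`‖δ‖² / (4 Δt)`, which the numerical dissipation absorbs, and by `½ Δt ‖∇ · u'‖²_∞ ‖v‖²`, which the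
time-step restriction and the Poincaré inequality (`norm_val_le`) reduce to a quarter of
`α̃_j ‖∇v‖²`. The forcing takes another quarter. What remains (`energy_step`) telescopes over the
time levels (`telescope_energy`), the viscosity fluctuations being dominated by the mean viscosity.

The starting values are arbitrary in `H¹₀`, so `u'` need not be bounded in the first two steps. All
integrals converge nevertheless, because `v` is a finite element function: `v` and `∇v` are
essentially bounded (`FEPair.essBounded`), the weak gradient being the classical one on each cell.
For the same reason the integration by parts (`integral_leibniz`) follows by density of the test
functions in the other two arguments, without Sobolev embeddings.
-/

namespace BDF2EEV

variable {d : ℕ} {D : Set (E d)}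

/-! ### Square-integrable fields and density of test functions -/

lemma memLp_coord {α ι : Type*} [Fintype ι] [MeasurableSpace α] {μ : Measure α}
    (w : Lp (EuclideanSpace ℝ ι) 2 μ) (i : ι) : MemLp (fun x => w x i) 2 μ :=
  (EuclideanSpace.proj i : EuclideanSpace ℝ ι →L[ℝ] ℝ).comp_memLp' (Lp.memLp w)

lemma continuous_integral_coord_mul {α ι : Type*} [Fintype ι] [MeasurableSpace α]
    {μ : Measure α} {g : α → ℝ} (hg : MemLp g 2 μ) (i : ι) :
    Continuous fun w : Lp (EuclideanSpace ℝ ι) 2 μ => ∫ x, w x i * g x ∂μ := by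
  classical
  have hs : MemLp (fun x => EuclideanSpace.single (𝕜 := ℝ) i (g x)) 2 μ := by
    refine hg.congr_norm ?_ (Eventually.of_forall fun x => by simp)
    have hc : Continuous fun t : ℝ => EuclideanSpace.single (𝕜 := ℝ) i t := by
      have h : (fun t : ℝ => EuclideanSpace.single (𝕜 := ℝ) i t)
          = fun t : ℝ => t • EuclideanSpace.single (𝕜 := ℝ) i (1 : ℝ) := by
        funext t; ext j; simp
      rw [h]; fun_prop
    exact hc.comp_aestronglyMeasurable hg.1
  have h : (fun w : Lp (EuclideanSpace ℝ ι) 2 μ => ∫ x, w x i * g x ∂μ)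
      = fun w => inner ℝ hs.toLp w := by
    funext w
    rw [L2.inner_def]
    refine integral_congr_ae ?_
    filter_upwards [hs.coeFn_toLp] with x hx
    rw [hx, EuclideanSpace.inner_single_left]
    simp [mul_comm]
  rw [h]
  fun_prop

lemma norm_sq_eq_integral {α F : Type*} [MeasurableSpace α] {μ : Measure α}
    [NormedAddCommGroup F] [InnerProductSpace ℝ F] (w : Lp F 2 μ) :
    ‖w‖ ^ 2 = ∫ x, ‖w x‖ ^ 2 ∂μ := by
  rw [← real_inner_self_eq_norm_sq, L2.inner_def]
  simp only [real_inner_self_eq_norm_sq]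

lemma integrable_norm_sq {α F : Type*} [MeasurableSpace α] {μ : Measure α}
    [NormedAddCommGroup F] (w : Lp F 2 μ) : Integrable (fun x => ‖w x‖ ^ 2) μ :=
  (memLp_two_iff_integrable_sq_norm (Lp.memLp w).1).1 (Lp.memLp w)

/-- A closed condition on pairs `(v, ∇v)` that holds for test functions holds on `H¹₀`. -/
lemma mem_of_isClosed {s : Set (Lp (E d) 2 (vol D) × Lp (Mat d) 2 (vol D))} (hs : IsClosed s)
    (h : ∀ w ∈ testPairs D, w ∈ s) (v : H10 D) : (val v, grad v) ∈ s :=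
  closure_minimal (s := (testPairs D : Set (Lp (E d) 2 (vol D) × Lp (Mat d) 2 (vol D)))) h hs v.2

lemma classicalGrad_apply {φ : E d → E d} {x : E d} (hφ : DifferentiableAt ℝ φ x)
    (i k : Fin d) :
    classicalGrad φ x (i, k) = fderiv ℝ (fun y => φ y i) x (EuclideanSpace.single k 1) := by
  have h := ((EuclideanSpace.proj i : E d →L[ℝ] ℝ).hasFDerivAt.comp x
    hφ.hasFDerivAt).fderiv
  have h' : fderiv ℝ (fun y => φ y i) x
      = (EuclideanSpace.proj i : E d →L[ℝ] ℝ).comp (fderiv ℝ φ x) := h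
  rw [h']
  simp [classicalGrad]

lemma contDiff_coord {n : WithTop ℕ∞} {φ : E d → E d} (hφ : ContDiff ℝ n φ) (i : Fin d) :
    ContDiff ℝ n fun y => φ y i :=
  (EuclideanSpace.proj i : E d →L[ℝ] ℝ).contDiff.comp hφ

lemma tsupport_coord_subset (φ : E d → E d) (i : Fin d) :
    tsupport (fun y => φ y i) ⊆ tsupport φ := by
  refine closure_mono fun x hx h0 => hx ?_
  simp [h0]

lemma continuous_fderiv_apply {f : E d → ℝ} (hf : ContDiff ℝ 1 f) (e : E d) :
    Continuous fun x => fderiv ℝ f x e :=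
  (hf.continuous_fderiv (by simp)).clm_apply continuous_const

lemma hasCompactSupport_fderiv_apply {f : E d → ℝ} (hf : HasCompactSupport f) (e : E d) :
    HasCompactSupport fun x => fderiv ℝ f x e :=
  hf.fderiv_apply ℝ e

lemma fderiv_apply_eq_zero {f : E d → ℝ} {x : E d} (hx : x ∉ tsupport f) (e : E d) :
    fderiv ℝ f x e = 0 := by
  have : fderiv ℝ f x = 0 := by
    by_contra h
    exact hx (support_fderiv_subset ℝ h)
  simp [this]

lemma integral_mul_fderiv_eq_neg {f g : E d → ℝ} (hf : ContDiff ℝ 1 f) (hg : ContDiff ℝ 1 g)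
    (hc : HasCompactSupport g) (e : E d) :
    ∫ x, f x * fderiv ℝ g x e = -∫ x, fderiv ℝ f x e * g x := by
  refine integral_mul_fderiv_eq_neg_fderiv_mul_of_integrable ?_ ?_ ?_
    (fun x _ => hf.differentiable (by simp) x) (fun x _ => hg.differentiable (by simp) x)
  · exact ((continuous_fderiv_apply hf e).mul hg.continuous).integrable_of_hasCompactSupport
      hc.mul_left
  · exact (hf.continuous.mul (continuous_fderiv_apply hg e)).integrable_of_hasCompactSupport
      (hasCompactSupport_fderiv_apply hc e).mul_left
  · exact (hf.continuous.mul hg.continuous).integrable_of_hasCompactSupport hc.mul_left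

lemma memLp_of_continuous_of_hasCompactSupport {g : E d → ℝ} (hg : Continuous g)
    (hc : HasCompactSupport g) : MemLp g 2 (vol D) :=
  (hg.memLp_of_hasCompactSupport hc).restrict D

/-- Integrals over `D` agree with those over the whole space if the integrand vanishes off `D`. -/
lemma integral_vol_eq {a b : E d → ℝ} (h : a =ᵐ[vol D] b) (h0 : ∀ x, x ∉ D → b x = 0) :
    ∫ x, a x ∂(vol D) = ∫ x, b x := by
  rw [← setIntegral_eq_integral_of_forall_compl_eq_zero h0]
  exact integral_congr_ae h

/-- The test function `ψ` need not vanish on the boundary of `D`, because `v` does. -/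
lemma integral_val_mul_fderiv (v : H10 D) {ψ : E d → ℝ} (hψ : ContDiff ℝ 1 ψ)
    (hc : HasCompactSupport ψ) (i k : Fin d) :
    ∫ x, val v x i * fderiv ℝ ψ x (EuclideanSpace.single k 1) ∂(vol D)
      = -∫ x, grad v x (i, k) * ψ x ∂(vol D) := by
  have h1 := continuous_integral_coord_mul (ι := Fin d) (memLp_of_continuous_of_hasCompactSupport
    (D := D) (continuous_fderiv_apply hψ (EuclideanSpace.single k 1))
    (hasCompactSupport_fderiv_apply hc _)) i
  have h2 := continuous_integral_coord_mul (ι := Fin d × Fin d)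
    (memLp_of_continuous_of_hasCompactSupport (D := D) hψ.continuous hc) (i, k)
  refine mem_of_isClosed (isClosed_eq (h1.comp continuous_fst) (h2.comp continuous_snd).neg) ?_ v
  rintro w ⟨φ, hφ, -, hφD, hw1, hw2⟩
  have hφ1 : ContDiff ℝ 1 φ := hφ.of_le (by simp)
  have hD : ∀ x, x ∉ D → x ∉ tsupport fun y => φ y i :=
    fun x hx h => hx (hφD (tsupport_coord_subset φ i h))
  have e1 : ∫ x, w.1 x i * fderiv ℝ ψ x (EuclideanSpace.single k 1) ∂(vol D)
      = ∫ x, φ x i * fderiv ℝ ψ x (EuclideanSpace.single k 1) := by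
    refine integral_vol_eq ?_ fun x hx => ?_
    · filter_upwards [hw1] with x hx
      rw [hx]
    · rw [image_eq_zero_of_notMem_tsupport (hD x hx), zero_mul]
  have e2 : ∫ x, w.2 x (i, k) * ψ x ∂(vol D)
      = ∫ x, fderiv ℝ (fun y => φ y i) x (EuclideanSpace.single k 1) * ψ x := by
    refine integral_vol_eq ?_ fun x hx => ?_
    · filter_upwards [hw2] with x hx
      rw [hx, classicalGrad_apply (hφ1.differentiable (by simp) x)]
    · rw [fderiv_apply_eq_zero (hD x hx), zero_mul]
  change ∫ x, w.1 x i * fderiv ℝ ψ x (EuclideanSpace.single k 1) ∂(vol D)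
    = -∫ x, w.2 x (i, k) * ψ x ∂(vol D)
  rw [e1, e2]
  exact integral_mul_fderiv_eq_neg (contDiff_coord hφ1 i) hψ hc _

/-! ### The Poincaré inequality -/

/-- Integrating `∂_k (x_k f²) = f² + 2 x_k f ∂_k f` and absorbing the last term. -/
lemma integral_sq_le_of_contDiff {f : E d → ℝ} (hf : ContDiff ℝ 1 f) (hc : HasCompactSupport f)
    {R : ℝ} (hR : ∀ x ∈ tsupport f, ‖x‖ ≤ R) (k : Fin d) :
    ∫ x, f x ^ 2 ≤ 4 * R ^ 2 * ∫ x, fderiv ℝ f x (EuclideanSpace.single k 1) ^ 2 := by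
  generalize he : (EuclideanSpace.single k 1 : E d) = e
  have hl : ContDiff ℝ 1 (fun x : E d => x k) := (EuclideanSpace.proj k : E d →L[ℝ] ℝ).contDiff
  have hld : ∀ x : E d, fderiv ℝ (fun y : E d => y k) x e = 1 := by
    intro x
    have h : fderiv ℝ (fun y : E d => y k) x = (EuclideanSpace.proj k : E d →L[ℝ] ℝ) :=
      (EuclideanSpace.proj k : E d →L[ℝ] ℝ).fderiv
    rw [h]
    simp [← he]
  have hfe : ∀ x, fderiv ℝ (fun y => f y ^ 2) x e = 2 * f x * fderiv ℝ f x e := by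
    intro x
    have := ((hf.differentiable (by simp) x).hasFDerivAt.pow 2).fderiv
    rw [this]
    simp
  have hsq : HasCompactSupport fun x => f x ^ 2 :=
    hc.comp_left (g := fun t : ℝ => t ^ 2) (by simp)
  have hf2 : ContDiff ℝ 1 fun y => f y ^ 2 := hf.pow 2
  have hI : ∫ x : E d, x k * (2 * f x * fderiv ℝ f x e) = -∫ x, f x ^ 2 := by
    have h := integral_mul_fderiv_eq_neg hl hf2 hsq e
    simp only [hld, hfe, one_mul] at h
    exact h
  have hcd := continuous_fderiv_apply hf e
  have i1 : Integrable fun x => f x ^ 2 :=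
    hf2.continuous.integrable_of_hasCompactSupport hsq
  have hcd2 : Continuous fun x => fderiv ℝ f x e ^ 2 := hcd.pow 2
  have hsd : HasCompactSupport fun x => fderiv ℝ f x e ^ 2 :=
    (hasCompactSupport_fderiv_apply hc e).comp_left (g := fun t : ℝ => t ^ 2) (by simp)
  have i2 : Integrable fun x => fderiv ℝ f x e ^ 2 :=
    hcd2.integrable_of_hasCompactSupport hsd
  have hcs : HasCompactSupport fun x : E d => x k * (2 * f x * fderiv ℝ f x e) :=
    ((hasCompactSupport_fderiv_apply hc e).mul_left (f := fun x => 2 * f x)).mul_left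
      (f := fun x : E d => x k)
  have hcc : Continuous fun x : E d => x k * (2 * f x * fderiv ℝ f x e) :=
    hl.continuous.mul ((continuous_const.mul hf.continuous).mul hcd)
  have i3 : Integrable fun x : E d => -(x k * (2 * f x * fderiv ℝ f x e)) :=
    (hcc.integrable_of_hasCompactSupport hcs).neg
  have hle : ∫ x, f x ^ 2 ≤ ∫ x, (1 / 2 * f x ^ 2 + 2 * R ^ 2 * fderiv ℝ f x e ^ 2) := by
    have h0 : ∫ x, f x ^ 2 = ∫ x, -(x k * (2 * f x * fderiv ℝ f x e)) := by
      rw [integral_neg]; linarith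
    rw [h0]
    refine integral_mono i3 ((i1.const_mul _).add (i2.const_mul _)) fun x => ?_
    simp only
    by_cases hx : x ∈ tsupport f
    · have hxk : (x k) ^ 2 ≤ R ^ 2 := by
        have h1 : |x k| ≤ R := (PiLp.norm_apply_le x k).trans (hR x hx)
        exact sq_le_sq' (by linarith [neg_abs_le (x k)]) ((le_abs_self _).trans h1)
      nlinarith [sq_nonneg (f x + 2 * x k * fderiv ℝ f x e),
        mul_le_mul_of_nonneg_right hxk (sq_nonneg (fderiv ℝ f x e))]
    · rw [image_eq_zero_of_notMem_tsupport hx, fderiv_apply_eq_zero hx]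
      simp
  rw [integral_add (i1.const_mul _) (i2.const_mul _), integral_const_mul, integral_const_mul] at hle
  linarith

lemma norm_val_le_of_mem_testPairs {R : ℝ} (hR0 : 0 ≤ R) (hR : ∀ x ∈ D, ‖x‖ ≤ R) (k : Fin d)
    {w : Lp (E d) 2 (vol D) × Lp (Mat d) 2 (vol D)} (hw : w ∈ testPairs D) :
    ‖w.1‖ ≤ 2 * R * ‖w.2‖ := by
  obtain ⟨φ, hφ, hc, hφD, hw1, hw2⟩ := hw
  have hφ1 : ContDiff ℝ 1 φ := hφ.of_le (by simp)
  have hD : ∀ i, ∀ x, x ∉ D → x ∉ tsupport fun y => φ y i :=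
    fun i x hx h => hx (hφD (tsupport_coord_subset φ i h))
  have hcomp : ∀ i : Fin d, ∫ x, w.1 x i ^ 2 ∂(vol D)
      ≤ 4 * R ^ 2 * ∫ x, w.2 x (i, k) ^ 2 ∂(vol D) := by
    intro i
    have e1 : ∫ x, w.1 x i ^ 2 ∂(vol D) = ∫ x, φ x i ^ 2 := by
      refine integral_vol_eq ?_ fun x hx => ?_
      · filter_upwards [hw1] with x hx
        rw [hx]
      · rw [image_eq_zero_of_notMem_tsupport (hD i x hx)]; simp
    have e2 : ∫ x, w.2 x (i, k) ^ 2 ∂(vol D)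
        = ∫ x, fderiv ℝ (fun y => φ y i) x (EuclideanSpace.single k 1) ^ 2 := by
      refine integral_vol_eq ?_ fun x hx => ?_
      · filter_upwards [hw2] with x hx
        rw [hx, classicalGrad_apply (hφ1.differentiable (by simp) x)]
      · rw [fderiv_apply_eq_zero (hD i x hx)]; simp
    rw [e1, e2]
    exact integral_sq_le_of_contDiff (contDiff_coord hφ1 i)
      (hc.of_isClosed_subset (isClosed_tsupport _) (tsupport_coord_subset φ i))
      (fun x hx => hR x (hφD (tsupport_coord_subset φ i hx))) k
  have hi : ∀ i, Integrable (fun x => w.1 x i ^ 2) (vol D) :=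
    fun i => (memLp_coord w.1 i).integrable_sq
  have hj : ∀ i, Integrable (fun x => w.2 x (i, k) ^ 2) (vol D) :=
    fun i => (memLp_coord w.2 (i, k)).integrable_sq
  have hsq : ‖w.1‖ ^ 2 ≤ (2 * R * ‖w.2‖) ^ 2 := by
    calc ‖w.1‖ ^ 2 = ∑ i, ∫ x, w.1 x i ^ 2 ∂(vol D) := by
          rw [norm_sq_eq_integral, ← integral_finsetSum _ fun i _ => hi i]
          simp only [EuclideanSpace.real_norm_sq_eq]
      _ ≤ ∑ i, 4 * R ^ 2 * ∫ x, w.2 x (i, k) ^ 2 ∂(vol D) :=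
          Finset.sum_le_sum fun i _ => hcomp i
      _ = 4 * R ^ 2 * ∫ x, ∑ i, w.2 x (i, k) ^ 2 ∂(vol D) := by
          rw [← Finset.mul_sum, integral_finsetSum _ fun i _ => hj i]
      _ ≤ 4 * R ^ 2 * ‖w.2‖ ^ 2 := by
          rw [norm_sq_eq_integral]
          refine mul_le_mul_of_nonneg_left (integral_mono (integrable_finsetSum _ fun i _ => hj i)
            (integrable_norm_sq w.2) fun x => ?_) (by positivity)
          simp only [EuclideanSpace.real_norm_sq_eq, Fintype.sum_prod_type]
          exact Finset.sum_le_sum fun i _ =>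
            Finset.single_le_sum (f := fun l => w.2 x (i, l) ^ 2) (fun l _ => sq_nonneg _)
              (Finset.mem_univ k)
      _ = (2 * R * ‖w.2‖) ^ 2 := by ring
  exact le_of_sq_le_sq hsq (by positivity)

lemma norm_val_le {R : ℝ} (hR0 : 0 ≤ R) (hR : ∀ x ∈ D, ‖x‖ ≤ R) (k : Fin d) (v : H10 D) :
    ‖val v‖ ≤ 2 * R * ‖grad v‖ :=
  mem_of_isClosed (s := {w | ‖w.1‖ ≤ 2 * R * ‖w.2‖})
    (isClosed_le (by fun_prop) (by fun_prop))
    (fun _ hw => norm_val_le_of_mem_testPairs hR0 hR k hw) v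

lemma IsConvexPolytopalDomain.isOpen (hD : IsConvexPolytopalDomain D) : IsOpen D := by
  obtain ⟨-, s, rfl⟩ := hD
  exact isOpen_interior

lemma IsConvexPolytopalDomain.exists_norm_le (hD : IsConvexPolytopalDomain D) :
    ∃ R : ℝ, 0 < R ∧ ∀ x ∈ D, ‖x‖ ≤ R := by
  obtain ⟨-, s, rfl⟩ := hD
  obtain ⟨R, hR, h⟩ := ((isBounded_convexHull (s := (s : Set (E d)))).2
    s.finite_toSet.isBounded).exists_pos_norm_le
  exact ⟨R, hR, fun x hx => h x (interior_subset hx)⟩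

/-- By the Poincaré inequality the supremum defining `‖f‖₋₁` is finite. -/
lemma abs_apply_le_normHMinus {P : ℝ} (hP : ∀ v : H10 D, ‖val v‖ ≤ P * ‖grad v‖)
    (f : HMinus D) (v : H10 D) : |f v| ≤ normHMinus f * ‖grad v‖ := by
  have hb : ∀ v : H10 D, |f v| ≤ ‖f‖ * max P 1 * ‖grad v‖ := by
    intro v
    have h2 : ‖v‖ ≤ max P 1 * ‖grad v‖ := by
      have h3 : ‖v‖ = max ‖val v‖ ‖grad v‖ := rfl
      rw [h3]
      refine max_le ((hP v).trans ?_) ?_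
      · exact mul_le_mul_of_nonneg_right (le_max_left _ _) (norm_nonneg _)
      · exact le_mul_of_one_le_left (norm_nonneg _) (le_max_right _ _)
    have h1 := f.le_opNorm v
    rw [Real.norm_eq_abs] at h1
    rw [mul_assoc]
    exact h1.trans (mul_le_mul_of_nonneg_left h2 (norm_nonneg _))
  rcases (norm_nonneg (grad v)).eq_or_lt with h0 | h0
  · have := hb v
    rw [← h0, mul_zero] at this ⊢
    exact this
  · rw [← div_le_iff₀ h0]
    refine le_ciSup (f := fun v : H10 D => |f v| / ‖grad v‖) ⟨‖f‖ * max P 1, ?_⟩ v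
    rintro _ ⟨w, rfl⟩
    exact div_le_of_le_mul₀ (norm_nonneg _)
      (mul_nonneg f.opNorm_nonneg (zero_le_one.trans (le_max_right _ _))) (hb w)

/-! ### Bounded velocities with bounded gradient -/

/-- The velocities of class `W^{1,∞}(D)`: those that are essentially bounded together with their
weak gradient. -/
def EssBounded (v : H10 D) : Prop :=
  ∃ B : ℝ, ∀ᵐ x ∂(vol D), ‖val v x‖ ≤ B ∧ ‖grad v x‖ ≤ B

lemma EssBounded.val_coord {v : H10 D} (hv : EssBounded v) (i : Fin d) :
    MemLp (fun x => val v x i) ∞ (vol D) := by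
  obtain ⟨B, hB⟩ := hv
  refine memLp_top_of_bound (memLp_coord (ι := Fin d) (val v) i).1 B ?_
  filter_upwards [hB] with x hx
  exact (PiLp.norm_apply_le (val v x) i).trans hx.1

lemma EssBounded.grad_coord {v : H10 D} (hv : EssBounded v) (i k : Fin d) :
    MemLp (fun x => grad v x (i, k)) ∞ (vol D) := by
  obtain ⟨B, hB⟩ := hv
  refine memLp_top_of_bound (memLp_coord (ι := Fin d × Fin d) (grad v) (i, k)).1 B ?_
  filter_upwards [hB] with x hx
  exact (PiLp.norm_apply_le (grad v x) (i, k)).trans hx.2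

lemma memLp_val_coord (v : H10 D) (i : Fin d) : MemLp (fun x => val v x i) 2 (vol D) :=
  memLp_coord (ι := Fin d) (val v) i

lemma memLp_grad_coord (v : H10 D) (i k : Fin d) :
    MemLp (fun x => grad v x (i, k)) 2 (vol D) :=
  memLp_coord (ι := Fin d × Fin d) (grad v) (i, k)

lemma memLp_top_mul {α : Type*} [MeasurableSpace α] {μ : Measure α} {f g : α → ℝ}
    (hf : MemLp f ∞ μ) (hg : MemLp g 2 μ) : MemLp (fun x => f x * g x) 2 μ :=
  hg.mul' hf

lemma memLp_mul_top {α : Type*} [MeasurableSpace α] {μ : Measure α} {f g : α → ℝ}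
    (hf : MemLp f 2 μ) (hg : MemLp g ∞ μ) : MemLp (fun x => f x * g x) 2 μ :=
  hg.mul' hf

lemma integrable_mul {α : Type*} [MeasurableSpace α] {μ : Measure α} {f g : α → ℝ}
    (hf : MemLp f 2 μ) (hg : MemLp g 2 μ) : Integrable (fun x => f x * g x) μ :=
  hf.integrable_mul hg

lemma continuous_classicalGrad {g : E d → E d} (hg : ContDiff ℝ 1 g) :
    Continuous (classicalGrad g) := by
  have h : classicalGrad g = fun x => WithLp.toLp 2 fun ik : Fin d × Fin d =>
      fderiv ℝ (fun y => g y ik.1) x (EuclideanSpace.single ik.2 1) := by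
    funext x
    ext ik
    exact classicalGrad_apply (hg.differentiable (by simp) x) ik.1 ik.2
  rw [h]
  exact (PiLp.continuous_toLp 2 _).comp
    (continuous_pi fun ik => continuous_fderiv_apply (contDiff_coord hg ik.1) _)

/-- Where a field in `H¹₀` is continuously differentiable its weak gradient is the classical
one. -/
lemma grad_ae_eq_classicalGrad [IsFiniteMeasure (vol D)] {K : Set (E d)} (hK : IsOpen K)
    (hKD : K ⊆ D) (v : H10 D) {g : E d → E d} (hg : ContDiff ℝ 1 g)
    (hv : val v =ᵐ[volume.restrict K] g) :
    ∀ᵐ x ∂(volume : Measure (E d)), x ∈ K → grad v x = classicalGrad g x := by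
  have hcoord : ∀ ik : Fin d × Fin d, ∀ᵐ x ∂(volume : Measure (E d)), x ∈ K →
      grad v x ik - fderiv ℝ (fun y => g y ik.1) x (EuclideanSpace.single ik.2 1) = 0 := by
    rintro ⟨i, k⟩
    have hgi := contDiff_coord hg i
    have hG := memLp_grad_coord v i k
    have hcd := continuous_fderiv_apply hgi (EuclideanSpace.single k 1)
    refine hK.ae_eq_zero_of_integral_contDiff_smul_eq_zero ?_ ?_
    · have hint : IntegrableOn (fun x => grad v x (i, k)) D volume := hG.integrable (by norm_num)
      exact (hint.mono_set hKD).locallyIntegrableOn.sub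
        (hcd.locallyIntegrable.locallyIntegrableOn K)
    · intro ψ hψ hc hψK
      have hψ1 : ContDiff ℝ 1 ψ := hψ.of_le (by simp)
      have hψD : ∀ x, x ∉ D → ψ x = 0 := fun x hx =>
        image_eq_zero_of_notMem_tsupport fun h => hx (hKD (hψK h))
      have i1 : Integrable (fun x => grad v x (i, k) * ψ x) (vol D) :=
        integrable_mul hG (memLp_of_continuous_of_hasCompactSupport hψ1.continuous hc)
      have i2 : Integrable
          (fun x => fderiv ℝ (fun y => g y i) x (EuclideanSpace.single k 1) * ψ x) (vol D) :=
        ((hcd.mul hψ1.continuous).integrable_of_hasCompactSupport hc.mul_left).restrict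
      have e0 : ∫ x, ψ x • (grad v x (i, k)
            - fderiv ℝ (fun y => g y i) x (EuclideanSpace.single k 1))
          = ∫ x, (grad v x (i, k) * ψ x
            - fderiv ℝ (fun y => g y i) x (EuclideanSpace.single k 1) * ψ x) ∂(vol D) := by
        symm
        refine integral_vol_eq (Eventually.of_forall fun x => ?_) fun x hx => ?_
        · simp only [smul_eq_mul]; ring
        · rw [hψD x hx, zero_smul]
      have e1 : ∫ x, val v x i * fderiv ℝ ψ x (EuclideanSpace.single k 1) ∂(vol D)
          = ∫ x, g x i * fderiv ℝ ψ x (EuclideanSpace.single k 1) := by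
        refine integral_vol_eq ?_ fun x hx => ?_
        · refine ae_restrict_of_ae ?_
          filter_upwards [(ae_restrict_iff' hK.measurableSet).1 hv] with x hx
          by_cases hxK : x ∈ K
          · rw [hx hxK]
          · rw [fderiv_apply_eq_zero fun h => hxK (hψK h), mul_zero, mul_zero]
        · rw [fderiv_apply_eq_zero fun h => hx (hKD (hψK h)), mul_zero]
      have e2 : ∫ x, fderiv ℝ (fun y => g y i) x (EuclideanSpace.single k 1) * ψ x ∂(vol D)
          = ∫ x, fderiv ℝ (fun y => g y i) x (EuclideanSpace.single k 1) * ψ x :=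
        integral_vol_eq (Eventually.of_forall fun _ => rfl) fun x hx => by
          rw [hψD x hx, mul_zero]
      have e3 := integral_val_mul_fderiv v hψ1 hc i k
      have e4 := integral_mul_fderiv_eq_neg hgi hψ1 hc (EuclideanSpace.single k 1)
      rw [e0, integral_sub i1 i2]
      linarith
  filter_upwards [ae_all_iff.2 hcoord] with x hx hxK
  ext ⟨i, k⟩
  rw [classicalGrad_apply (hg.differentiable (by simp) x)]
  exact sub_eq_zero.1 (hx (i, k) hxK)

/-- The domain is bounded and on each cell the field is `C¹` up to the boundary, so that it and its
gradient are bounded on each of the finitely many cells. -/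
lemma FEPair.essBounded [IsFiniteMeasure (vol D)] (hD : IsOpen D) {R : ℝ}
    (hR : ∀ x ∈ D, ‖x‖ ≤ R) (S : FEPair D) {v : H10 D} (hv : v ∈ S.Xh) : EssBounded v := by
  have hcell : ∀ K ∈ S.cells, ∃ B : ℝ, ∀ᵐ x ∂(volume : Measure (E d)), x ∈ K →
      ‖val v x‖ ≤ B ∧ ‖grad v x‖ ≤ B := by
    intro K hK
    obtain ⟨g, hg, hvg⟩ := S.piecewise v hv K hK
    have hKo := S.isMesh.isOpen K hK
    have hKD := S.isMesh.subset K hK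
    obtain ⟨B₁, hB₁⟩ := (isCompact_closedBall (0 : E d) R).exists_bound_of_continuousOn
      hg.continuous.continuousOn
    obtain ⟨B₂, hB₂⟩ := (isCompact_closedBall (0 : E d) R).exists_bound_of_continuousOn
      (continuous_classicalGrad hg).continuousOn
    refine ⟨max B₁ B₂, ?_⟩
    filter_upwards [(ae_restrict_iff' hKo.measurableSet).1 hvg,
      grad_ae_eq_classicalGrad hKo hKD v hg hvg] with x h1 h2 hxK
    have hx : x ∈ Metric.closedBall (0 : E d) R := by simpa using hR x (hKD hxK)
    rw [h1 hxK, h2 hxK]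
    exact ⟨(hB₁ x hx).trans (le_max_left _ _), (hB₂ x hx).trans (le_max_right _ _)⟩
  choose! B hB using hcell
  refine ⟨∑ K ∈ S.cells, |B K|, ?_⟩
  have hall : ∀ᵐ x ∂(volume : Measure (E d)), ∀ K ∈ S.cells, x ∈ K →
      ‖val v x‖ ≤ B K ∧ ‖grad v x‖ ≤ B K :=
    (ae_ball_iff S.cells.countable_toSet).2 hB
  have hcov : ∀ᵐ x ∂(volume : Measure (E d)), x ∉ D \ ⋃ K ∈ S.cells, K :=
    measure_eq_zero_iff_ae_notMem.1 S.isMesh.cover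
  refine (ae_restrict_iff' hD.measurableSet).2 ?_
  filter_upwards [hall, hcov] with x h1 h2 hxD
  have hx : x ∈ ⋃ K ∈ S.cells, K := by
    by_contra h
    exact h2 ⟨hxD, h⟩
  obtain ⟨K, hK, hxK⟩ := Set.mem_iUnion₂.1 hx
  have hle : B K ≤ ∑ K ∈ S.cells, |B K| := (le_abs_self _).trans
    (Finset.single_le_sum (f := fun K => |B K|) (fun _ _ => abs_nonneg _) hK)
  exact ⟨(h1 K hK hxK).1.trans hle, (h1 K hK hxK).2.trans hle⟩

/-! ### Integration by parts in the convective term -/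

/-- The weak derivative of `v` tested with the product `a b`. -/
lemma integral_leibniz_of_contDiff (v : H10 D) {a b : E d → ℝ} (ha : ContDiff ℝ 1 a)
    (hac : HasCompactSupport a) (hb : ContDiff ℝ 1 b) (hbc : HasCompactSupport b)
    (i k : Fin d) :
    ∫ x, a x * (grad v x (i, k) * b x) ∂(vol D)
      + ∫ x, a x * (val v x i * fderiv ℝ b x (EuclideanSpace.single k 1)) ∂(vol D)
      + ∫ x, fderiv ℝ a x (EuclideanSpace.single k 1) * (val v x i * b x) ∂(vol D) = 0 := by
  generalize he : (EuclideanSpace.single k 1 : E d) = e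
  have hab : ContDiff ℝ 1 fun x => a x * b x := ha.mul hb
  have habc : HasCompactSupport fun x => a x * b x := hac.mul_right
  have hd : ∀ x, fderiv ℝ (fun x => a x * b x) x e = a x * fderiv ℝ b x e + fderiv ℝ a x e * b x := by
    intro x
    rw [fderiv_fun_mul (ha.differentiable (by simp) x) (hb.differentiable (by simp) x)]
    simp [mul_comm]
  have h := integral_val_mul_fderiv v hab habc i k
  rw [he] at h
  have c1 : Continuous fun x => a x * fderiv ℝ b x e :=
    ha.continuous.mul (continuous_fderiv_apply hb e)
  have c2 : Continuous fun x => fderiv ℝ a x e * b x :=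
    (continuous_fderiv_apply ha e).mul hb.continuous
  have s1 : HasCompactSupport fun x => a x * fderiv ℝ b x e := hac.mul_right
  have s2 : HasCompactSupport fun x => fderiv ℝ a x e * b x := hbc.mul_left
  have i1 : Integrable (fun x => val v x i * (a x * fderiv ℝ b x e)) (vol D) :=
    integrable_mul (memLp_val_coord v i) (memLp_of_continuous_of_hasCompactSupport c1 s1)
  have i2 : Integrable (fun x => val v x i * (fderiv ℝ a x e * b x)) (vol D) :=
    integrable_mul (memLp_val_coord v i) (memLp_of_continuous_of_hasCompactSupport c2 s2)
  simp only [hd, mul_add] at h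
  rw [integral_add i1 i2] at h
  have r1 : ∫ x, a x * (grad v x (i, k) * b x) ∂(vol D)
      = ∫ x, grad v x (i, k) * (a x * b x) ∂(vol D) := integral_congr_ae
    (Eventually.of_forall fun x => mul_left_comm _ _ _)
  have r2 : ∫ x, a x * (val v x i * fderiv ℝ b x e) ∂(vol D)
      = ∫ x, val v x i * (a x * fderiv ℝ b x e) ∂(vol D) := integral_congr_ae
    (Eventually.of_forall fun x => mul_left_comm _ _ _)
  have r3 : ∫ x, fderiv ℝ a x e * (val v x i * b x) ∂(vol D)
      = ∫ x, val v x i * (fderiv ℝ a x e * b x) ∂(vol D) := integral_congr_ae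
    (Eventually.of_forall fun x => mul_left_comm _ _ _)
  rw [r1, r2, r3]
  linarith

/-- `∫ ∂_k (u_l v_i w_i) = 0` with the product rule. Since `v` is bounded with bounded gradient,
all three integrals are continuous in `u` and in `w` for the `H¹` norm, so that it is enough to
take test functions for `u` and `w`. -/
lemma integral_leibniz {v : H10 D} (hv : EssBounded v) (u w : H10 D) (i k l : Fin d) :
    ∫ x, val u x l * (grad v x (i, k) * val w x i) ∂(vol D)
      + ∫ x, val u x l * (val v x i * grad w x (i, k)) ∂(vol D)
      + ∫ x, grad u x (l, k) * (val v x i * val w x i) ∂(vol D) = 0 := by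
  -- The identity for two test functions, then for a general `u`, then for a general `w`.
  have key : ∀ u' ∈ testPairs D, ∀ w' ∈ testPairs D,
      ∫ x, u'.1 x l * (grad v x (i, k) * w'.1 x i) ∂(vol D)
      + ∫ x, u'.1 x l * (val v x i * w'.2 x (i, k)) ∂(vol D)
      + ∫ x, u'.2 x (l, k) * (val v x i * w'.1 x i) ∂(vol D) = 0 := by
    rintro u' ⟨φ, hφ, hφc, -, hu1, hu2⟩ w' ⟨ψ, hψ, hψc, -, hw1, hw2⟩
    have hφ1 : ContDiff ℝ 1 φ := hφ.of_le (by simp)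
    have hψ1 : ContDiff ℝ 1 ψ := hψ.of_le (by simp)
    rw [← integral_leibniz_of_contDiff v (contDiff_coord hφ1 l)
      (hφc.of_isClosed_subset (isClosed_tsupport _) (tsupport_coord_subset φ l))
      (contDiff_coord hψ1 i)
      (hψc.of_isClosed_subset (isClosed_tsupport _) (tsupport_coord_subset ψ i)) i k]
    congr 1
    · congr 1
      · refine integral_congr_ae ?_
        filter_upwards [hu1, hw1] with x h1 h2
        rw [h1, h2]
      · refine integral_congr_ae ?_
        filter_upwards [hu1, hw2] with x h1 h2
        rw [h1, h2, classicalGrad_apply (hψ1.differentiable (by simp) x)]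
    · refine integral_congr_ae ?_
      filter_upwards [hu2, hw1] with x h1 h2
      rw [h1, h2, classicalGrad_apply (hφ1.differentiable (by simp) x)]
  have step : ∀ w' ∈ testPairs D,
      ∫ x, val u x l * (grad v x (i, k) * w'.1 x i) ∂(vol D)
      + ∫ x, val u x l * (val v x i * w'.2 x (i, k)) ∂(vol D)
      + ∫ x, grad u x (l, k) * (val v x i * w'.1 x i) ∂(vol D) = 0 := by
    intro w' hw'
    have c1 := continuous_integral_coord_mul (ι := Fin d)
      (memLp_top_mul (hv.grad_coord i k) (memLp_coord (ι := Fin d) w'.1 i)) l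
    have c2 := continuous_integral_coord_mul (ι := Fin d)
      (memLp_top_mul (hv.val_coord i) (memLp_coord (ι := Fin d × Fin d) w'.2 (i, k))) l
    have c3 := continuous_integral_coord_mul (ι := Fin d × Fin d)
      (memLp_top_mul (hv.val_coord i) (memLp_coord (ι := Fin d) w'.1 i)) (l, k)
    exact mem_of_isClosed (isClosed_eq (((c1.comp continuous_fst).add
      (c2.comp continuous_fst)).add (c3.comp continuous_snd)) continuous_const)
      (fun u' hu' => key u' hu' w' hw') u
  have c1 := continuous_integral_coord_mul (ι := Fin d)
    (memLp_mul_top (memLp_val_coord u l) (hv.grad_coord i k)) i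
  have c2 := continuous_integral_coord_mul (ι := Fin d × Fin d)
    (memLp_mul_top (memLp_val_coord u l) (hv.val_coord i)) (i, k)
  have c3 := continuous_integral_coord_mul (ι := Fin d)
    (memLp_mul_top (memLp_grad_coord u l k) (hv.val_coord i)) i
  have hcomm : ∀ p q r : ℝ, r * (p * q) = p * (q * r) := fun p q r => by ring
  have c1' := c1.congr fun w' => integral_congr_ae (Eventually.of_forall fun x => hcomm _ _ _)
  have c2' := c2.congr fun w' => integral_congr_ae (Eventually.of_forall fun x => hcomm _ _ _)
  have c3' := c3.congr fun w' => integral_congr_ae (Eventually.of_forall fun x => hcomm _ _ _)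
  exact mem_of_isClosed (isClosed_eq (((c1'.comp continuous_fst).add
    (c2'.comp continuous_snd)).add (c3'.comp continuous_fst)) continuous_const) step w

lemma dvg_ae_eq (u : H10 D) :
    ∀ᵐ x ∂(vol D), dvg u x = ∑ k, grad u x (k, k) := by
  filter_upwards [(trace d).coeFn_compLp (grad u)] with x hx
  rw [dvg, hx]
  simp [trace]

lemma conv_eq_sum {u v w : H10 D}
    (h : ∀ i k, Integrable (fun x => val u x k * grad v x (i, k) * val w x i) (vol D)) :
    conv u v w = ∑ i, ∑ k, ∫ x, val u x k * grad v x (i, k) * val w x i ∂(vol D) := by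
  rw [conv, integral_finsetSum _ fun i _ => integrable_finsetSum _ fun k _ => h i k]
  exact Finset.sum_congr rfl fun i _ => integral_finsetSum _ fun k _ => h i k

lemma integrable_conv_of_mid {v : H10 D} (hv : EssBounded v) (u w : H10 D) (i k : Fin d) :
    Integrable (fun x => val u x k * grad v x (i, k) * val w x i) (vol D) :=
  integrable_mul (memLp_mul_top (memLp_val_coord u k) (hv.grad_coord i k)) (memLp_val_coord w i)

lemma integrable_conv_of_right {w : H10 D} (hw : EssBounded w) (u v : H10 D) (i k : Fin d) :
    Integrable (fun x => val u x k * grad v x (i, k) * val w x i) (vol D) := by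
  have h := integrable_mul (memLp_mul_top (memLp_val_coord u k) (hw.val_coord i))
    (memLp_grad_coord v i k)
  refine h.congr (Eventually.of_forall fun x => ?_)
  simp only; ring

lemma integrable_inner_val {v : H10 D} (hv : EssBounded v) (u w : H10 D) (i k : Fin d) :
    Integrable (fun x => grad u x (k, k) * (val v x i * val w x i)) (vol D) :=
  integrable_mul (memLp_grad_coord u k k) (memLp_top_mul (hv.val_coord i) (memLp_val_coord w i))

/-- `b*(u, v, w) = (u · ∇v, w) + ½ ((∇ · u) v, w)`. -/
lemma bStar_eq {v : H10 D} (hv : EssBounded v) (u w : H10 D) :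
    bStar u v w = conv u v w
      + 1 / 2 * ∫ x, dvg u x * inner ℝ (val v x) (val w x) ∂(vol D) := by
  have hdiv : ∫ x, dvg u x * inner ℝ (val v x) (val w x) ∂(vol D)
      = ∑ i, ∑ k, ∫ x, grad u x (k, k) * (val v x i * val w x i) ∂(vol D) := by
    have h1 : ∫ x, dvg u x * inner ℝ (val v x) (val w x) ∂(vol D)
        = ∫ x, ∑ i, ∑ k, grad u x (k, k) * (val v x i * val w x i) ∂(vol D) := by
      refine integral_congr_ae ?_
      filter_upwards [dvg_ae_eq u] with x hx
      rw [hx, Finset.sum_comm, PiLp.inner_apply, Finset.sum_mul_sum]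
      simp [mul_comm]
    rw [h1, integral_finsetSum _ fun i _ =>
      integrable_finsetSum _ fun k _ => integrable_inner_val hv u w i k]
    exact Finset.sum_congr rfl fun i _ =>
      integral_finsetSum _ fun k _ => integrable_inner_val hv u w i k
  have hparts : conv u w v = -conv u v w
      - ∫ x, dvg u x * inner ℝ (val v x) (val w x) ∂(vol D) := by
    rw [hdiv, conv_eq_sum (integrable_conv_of_right hv u w),
      conv_eq_sum (integrable_conv_of_mid hv u w), ← Finset.sum_neg_distrib,
      ← Finset.sum_sub_distrib]
    refine Finset.sum_congr rfl fun i _ => ?_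
    rw [← Finset.sum_neg_distrib, ← Finset.sum_sub_distrib]
    refine Finset.sum_congr rfl fun k _ => ?_
    have h := integral_leibniz hv u w i k k
    have r1 : ∫ x, val u x k * (grad v x (i, k) * val w x i) ∂(vol D)
        = ∫ x, val u x k * grad v x (i, k) * val w x i ∂(vol D) :=
      integral_congr_ae (Eventually.of_forall fun x => (mul_assoc _ _ _).symm)
    have r2 : ∫ x, val u x k * (val v x i * grad w x (i, k)) ∂(vol D)
        = ∫ x, val u x k * grad w x (i, k) * val v x i ∂(vol D) :=
      integral_congr_ae (Eventually.of_forall fun x => by simp only; ring)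
    rw [r1, r2] at h
    linarith
  rw [bStar, hparts]
  ring

lemma val_sub_ae (v w : H10 D) : ∀ᵐ x ∂(vol D), val (v - w) x = val v x - val w x :=
  Lp.coeFn_sub (val v) (val w)

lemma grad_sub_ae (v w : H10 D) : ∀ᵐ x ∂(vol D), grad (v - w) x = grad v x - grad w x :=
  Lp.coeFn_sub (grad v) (grad w)

lemma grad_smul_ae (c : ℝ) (v : H10 D) : ∀ᵐ x ∂(vol D), grad (c • v) x = c • grad v x :=
  Lp.coeFn_smul c (grad v)

lemma conv_sub_right {v : H10 D} (hv : EssBounded v) (u w w' : H10 D) :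
    conv u v (w - w') = conv u v w - conv u v w' := by
  rw [conv_eq_sum (integrable_conv_of_mid hv u _), conv_eq_sum (integrable_conv_of_mid hv u _),
    conv_eq_sum (integrable_conv_of_mid hv u _), ← Finset.sum_sub_distrib]
  refine Finset.sum_congr rfl fun i _ => ?_
  rw [← Finset.sum_sub_distrib]
  refine Finset.sum_congr rfl fun k _ => ?_
  rw [← integral_sub (integrable_conv_of_mid hv u w i k) (integrable_conv_of_mid hv u w' i k)]
  refine integral_congr_ae ?_
  filter_upwards [val_sub_ae w w'] with x hx
  rw [hx, PiLp.sub_apply]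
  ring

lemma conv_sub_mid {v : H10 D} (hv : EssBounded v) (u w w' : H10 D) :
    conv u (w - w') v = conv u w v - conv u w' v := by
  rw [conv_eq_sum (integrable_conv_of_right hv u _),
    conv_eq_sum (integrable_conv_of_right hv u _),
    conv_eq_sum (integrable_conv_of_right hv u _), ← Finset.sum_sub_distrib]
  refine Finset.sum_congr rfl fun i _ => ?_
  rw [← Finset.sum_sub_distrib]
  refine Finset.sum_congr rfl fun k _ => ?_
  rw [← integral_sub (integrable_conv_of_right hv u w i k) (integrable_conv_of_right hv u w' i k)]
  refine integral_congr_ae ?_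
  filter_upwards [grad_sub_ae w w'] with x hx
  rw [hx, PiLp.sub_apply]
  ring

/-- By skew-symmetry only the increment `v - w` contributes to `b*(u, w, v)`. -/
lemma bStar_eq_bStar_sub {v : H10 D} (hv : EssBounded v) (u w : H10 D) :
    bStar u w v = bStar u v (v - w) := by
  simp only [bStar, conv_sub_right hv, conv_sub_mid hv]
  ring

/-! ### Bounds for the convective and viscous terms -/

lemma ae_norm_le_of_memLp_top {α F : Type*} [MeasurableSpace α] {μ : Measure α}
    [NormedAddCommGroup F] {g : α → F} (hg : MemLp g ∞ μ) :
    ∀ᵐ x ∂μ, ‖g x‖ ≤ (eLpNorm g ∞ μ).toReal := by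
  have h := ae_le_eLpNormEssSup (f := g) (μ := μ)
  rw [← eLpNorm_exponent_top] at h
  filter_upwards [h] with x hx
  rw [← toReal_enorm]
  exact ENNReal.toReal_mono hg.2.ne hx

lemma integrable_mul_norm_sq {v : H10 D} (hv : EssBounded v) {h : E d → ℝ}
    (hh : Integrable h (vol D)) : Integrable (fun x => h x * ‖grad v x‖ ^ 2) (vol D) := by
  obtain ⟨B, hB⟩ := hv
  refine hh.mul_bdd (c := B ^ 2) (integrable_norm_sq (grad v)).1 ?_
  filter_upwards [hB] with x hx
  rw [norm_pow, norm_norm]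
  exact pow_le_pow_left₀ (norm_nonneg _) hx.2 2

lemma abs_sum_mul_le (a b : E d) (G : Mat d) :
    |∑ i, ∑ k, a k * G (i, k) * b i| ≤ ‖a‖ * ‖G‖ * ‖b‖ := by
  refine abs_le_of_sq_le_sq ?_ (by positivity)
  have h := Finset.sum_mul_sq_le_sq_mul_sq Finset.univ (fun ik : Fin d × Fin d => G ik)
    (fun ik => b ik.1 * a ik.2)
  have e1 : ∑ ik : Fin d × Fin d, (b ik.1 * a ik.2) ^ 2 = ‖b‖ ^ 2 * ‖a‖ ^ 2 := by
    rw [EuclideanSpace.real_norm_sq_eq, EuclideanSpace.real_norm_sq_eq, Finset.sum_mul_sum,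
      Fintype.sum_prod_type]
    simp only [mul_pow]
  have e2 : ∑ ik : Fin d × Fin d, G ik * (b ik.1 * a ik.2)
      = ∑ i, ∑ k, a k * G (i, k) * b i := by
    rw [Fintype.sum_prod_type]
    exact Finset.sum_congr rfl fun i _ => Finset.sum_congr rfl fun k _ => by ring
  rw [e1, e2, ← EuclideanSpace.real_norm_sq_eq] at h
  calc _ ≤ _ := h
    _ = _ := by ring

/-- The part of `b*` that the eddy viscosity absorbs is the one with `|u|² |∇v|²`. -/
lemma abs_bStar_le {v : H10 D} (hv : EssBounded v) (u w : H10 D) {B τ : ℝ} (hτ : 0 < τ)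
    (hB : ∀ᵐ x ∂(vol D), |dvg u x| ≤ B) :
    |bStar u v w| ≤ 2 * τ * ∫ x, ‖val u x‖ ^ 2 * ‖grad v x‖ ^ 2 ∂(vol D)
      + 1 / 2 * τ * B ^ 2 * ‖val v‖ ^ 2 + 1 / (4 * τ) * ‖val w‖ ^ 2 := by
  have young : ∀ p q : ℝ, p * q ≤ 2 * τ * p ^ 2 + 1 / (8 * τ) * q ^ 2 := by
    intro p q
    have h : 2 * τ * p ^ 2 + 1 / (8 * τ) * q ^ 2 - p * q
        = 1 / (8 * τ) * (4 * τ * p - q) ^ 2 := by field_simp; ring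
    have : 0 ≤ 1 / (8 * τ) * (4 * τ * p - q) ^ 2 := by positivity
    linarith
  have iu := (integrable_mul_norm_sq hv (integrable_norm_sq (val u))).const_mul (2 * τ)
  have iv := (integrable_norm_sq (val v)).const_mul (1 / 2 * τ * B ^ 2)
  have iw := (integrable_norm_sq (val w)).const_mul (1 / (8 * τ))
  have h1 : |conv u v w| ≤ 2 * τ * ∫ x, ‖val u x‖ ^ 2 * ‖grad v x‖ ^ 2 ∂(vol D)
      + 1 / (8 * τ) * ‖val w‖ ^ 2 := by
    rw [norm_sq_eq_integral, ← integral_const_mul, ← integral_const_mul, ← integral_add iu iw,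
      conv, ← Real.norm_eq_abs]
    refine norm_integral_le_of_norm_le (μ := vol D) (iu.add iw)
      (Eventually.of_forall fun x => ?_)
    have h := abs_sum_mul_le (val u x) (val w x) (grad v x)
    have h' := young (‖val u x‖ * ‖grad v x‖) ‖val w x‖
    rw [mul_pow] at h'
    exact h.trans h'
  have h2 : |∫ x, dvg u x * inner ℝ (val v x) (val w x) ∂(vol D)|
      ≤ 2 * (1 / 2 * τ * B ^ 2 * ‖val v‖ ^ 2 + 1 / (8 * τ) * ‖val w‖ ^ 2) := by
    rw [norm_sq_eq_integral, norm_sq_eq_integral, ← integral_const_mul, ← integral_const_mul,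
      ← integral_add iv iw, ← integral_const_mul, ← Real.norm_eq_abs]
    have ivw : Integrable (fun x => 2 * (1 / 2 * τ * B ^ 2 * ‖val v x‖ ^ 2
        + 1 / (8 * τ) * ‖val w x‖ ^ 2)) (vol D) := (iv.add iw).const_mul 2
    refine norm_integral_le_of_norm_le ivw ?_
    filter_upwards [hB] with x hx
    have hi := abs_real_inner_le_norm (val v x) (val w x)
    have h' := young (1 / 2 * B * ‖val v x‖) ‖val w x‖
    rw [Real.norm_eq_abs, abs_mul]
    have h3 := mul_le_mul hx hi (abs_nonneg _) ((abs_nonneg _).trans hx)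
    nlinarith
  rw [bStar_eq hv]
  calc |conv u v w + 1 / 2 * ∫ x, dvg u x * inner ℝ (val v x) (val w x) ∂(vol D)|
      ≤ |conv u v w| + 1 / 2 * |∫ x, dvg u x * inner ℝ (val v x) (val w x) ∂(vol D)| := by
        refine (abs_add_le _ _).trans (le_of_eq ?_)
        rw [abs_mul, abs_of_pos (by norm_num : (0 : ℝ) < 1 / 2)]
    _ ≤ _ := by
        have h8 : 1 / (4 * τ) * ‖val w‖ ^ 2
            = 1 / (8 * τ) * ‖val w‖ ^ 2 + 1 / (8 * τ) * ‖val w‖ ^ 2 := by field_simp; ring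
        linarith

lemma le_wGrad_self {a : E d → ℝ} (ha : MemLp a ∞ (vol D)) {m : ℝ}
    (hm : ∀ᵐ x ∂(vol D), m ≤ a x) (v : H10 D) : m * ‖grad v‖ ^ 2 ≤ wGrad a v v := by
  rw [norm_sq_eq_integral, ← integral_const_mul, wGrad]
  have hi := integrable_norm_sq (grad v)
  simp only [real_inner_self_eq_norm_sq]
  refine integral_mono_ae (hi.const_mul m) ?_ ?_
  · exact hi.bdd_mul (c := (eLpNorm a ∞ (vol D)).toReal) ha.1 (ae_norm_le_of_memLp_top ha)
  · filter_upwards [hm] with x hx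
    exact mul_le_mul_of_nonneg_right hx (sq_nonneg _)

lemma abs_wGrad_extrapolation_le {a : E d → ℝ} {s : ℝ} (hs : ∀ᵐ x ∂(vol D), ‖a x‖ ≤ s)
    (y z v : H10 D) :
    |wGrad a ((2 : ℝ) • y - z) v|
      ≤ s * (‖grad y‖ ^ 2 + 3 / 2 * ‖grad v‖ ^ 2 + 1 / 2 * ‖grad z‖ ^ 2) := by
  have iy := integrable_norm_sq (grad y)
  have iv := (integrable_norm_sq (grad v)).const_mul (3 / 2)
  have iz := (integrable_norm_sq (grad z)).const_mul (1 / 2)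
  have iyv : Integrable (fun x => ‖grad y x‖ ^ 2 + 3 / 2 * ‖grad v x‖ ^ 2) (vol D) := iy.add iv
  have iyvz : Integrable (fun x => s * (‖grad y x‖ ^ 2 + 3 / 2 * ‖grad v x‖ ^ 2
      + 1 / 2 * ‖grad z x‖ ^ 2)) (vol D) := (iyv.add iz).const_mul s
  rw [norm_sq_eq_integral, norm_sq_eq_integral, norm_sq_eq_integral, ← integral_const_mul,
    ← integral_const_mul, ← integral_add iy iv, ← integral_add iyv iz, ← integral_const_mul,
    wGrad, ← Real.norm_eq_abs]
  refine norm_integral_le_of_norm_le iyvz ?_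
  filter_upwards [hs, grad_sub_ae ((2 : ℝ) • y) z, grad_smul_ae 2 y] with x h1 h2 h3
  rw [h2, h3, Real.norm_eq_abs, abs_mul]
  have h4 : |inner ℝ ((2 : ℝ) • grad y x - grad z x) (grad v x)|
      ≤ 2 * (‖grad y x‖ * ‖grad v x‖) + ‖grad z x‖ * ‖grad v x‖ := by
    rw [inner_sub_left, real_inner_smul_left]
    refine (abs_sub _ _).trans ?_
    rw [abs_mul, abs_two]
    exact add_le_add (mul_le_mul_of_nonneg_left (abs_real_inner_le_norm _ _) zero_le_two)
      (abs_real_inner_le_norm _ _)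
  refine mul_le_mul h1 (h4.trans ?_) (abs_nonneg _) ((norm_nonneg _).trans h1)
  nlinarith [sq_nonneg (‖grad y x‖ - ‖grad v x‖), sq_nonneg (‖grad z x‖ - ‖grad v x‖)]

lemma le_wGrad_eddyViscosity {J : ℕ} {μ Δt : ℝ} (hμ : 1 ≤ μ) (hΔt : 0 < Δt)
    (u : Fin J → ℕ → H10 D) (j : Fin J) (n : ℕ) {v : H10 D} (hv : EssBounded v) :
    2 * Δt * ∫ x, ‖val (fluct u j n) x‖ ^ 2 * ‖grad v x‖ ^ 2 ∂(vol D)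
      ≤ wGrad (fun x => 2 * eddyViscosity μ Δt u n x) v v := by
  have he : ∀ x, 2 * eddyViscosity μ Δt u n x
      = 2 * (μ * Δt) * ∑ l, ‖val (fluct u l n) x‖ ^ 2 := by
    intro x
    rw [eddyViscosity, mixingLength, Real.sq_sqrt (Finset.sum_nonneg fun _ _ => sq_nonneg _)]
    ring
  rw [wGrad, ← integral_const_mul]
  simp only [he, real_inner_self_eq_norm_sq]
  refine integral_mono
    ((integrable_mul_norm_sq hv (integrable_norm_sq (val (fluct u j n)))).const_mul _)
    (integrable_mul_norm_sq hv ((integrable_finsetSum _ fun l _ =>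
      integrable_norm_sq (val (fluct u l n))).const_mul _)) fun x => ?_
  have h1 : ‖val (fluct u j n) x‖ ^ 2 ≤ ∑ l, ‖val (fluct u l n) x‖ ^ 2 :=
    Finset.single_le_sum (f := fun l => ‖val (fluct u l n) x‖ ^ 2) (fun _ _ => sq_nonneg _)
      (Finset.mem_univ j)
  have h2 : 2 * Δt ≤ 2 * (μ * Δt) := by nlinarith
  simp only
  rw [← mul_assoc]
  exact mul_le_mul_of_nonneg_right (mul_le_mul h2 h1 (sq_nonneg _) (by positivity)) (sq_nonneg _)

/-! ### The viscosities -/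

lemma memLp_nuBar {J : ℕ} {ν : Fin J → E d → ℝ} (hν : ∀ j, MemLp (ν j) ∞ (vol D)) :
    MemLp (nuBar ν) ∞ (vol D) :=
  (memLp_finsetSum Finset.univ fun j _ => hν j).const_mul (1 / (J : ℝ))

lemma nuBarMin_le {J : ℕ} {ν : Fin J → E d → ℝ}
    (hν : ∀ j, ∃ c : ℝ, 0 < c ∧ ∀ᵐ x ∂(vol D), c ≤ ν j x) :
    ∀ᵐ x ∂(vol D), nuBarMin D ν ≤ nuBar ν x := by
  refine ae_essInf_le (isBoundedUnder_of_eventually_ge (a := 0) ?_)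
  have h : ∀ᵐ x ∂(vol D), ∀ j, 0 ≤ ν j x := ae_all_iff.2 fun j => by
    obtain ⟨c, hc, h⟩ := hν j
    filter_upwards [h] with x hx using hc.le.trans hx
  filter_upwards [h] with x hx
  exact mul_nonneg (by positivity) (Finset.sum_nonneg fun j _ => hx j)

lemma norm_nuPrime_le {J : ℕ} {ν : Fin J → E d → ℝ} (hν : ∀ j, MemLp (ν j) ∞ (vol D))
    (j : Fin J) : ∀ᵐ x ∂(vol D), ‖nuPrime ν j x‖ ≤ nuPrimeSup D ν j :=
  ae_norm_le_of_memLp_top ((hν j).sub (memLp_nuBar hν))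

/-! ### The energy inequality -/

/-- The polarization identity behind the G-stability of BDF-2. -/
lemma bdf2_identity {F : Type*} [NormedAddCommGroup F] [InnerProductSpace ℝ F] (a b c : F) :
    6 * inner ℝ a a - 8 * inner ℝ b a + 2 * inner ℝ c a
      = ‖a‖ ^ 2 + ‖(2 : ℝ) • a - b‖ ^ 2 - ‖b‖ ^ 2 - ‖(2 : ℝ) • b - c‖ ^ 2
        + ‖a - ((2 : ℝ) • b - c)‖ ^ 2 := by
  simp only [← real_inner_self_eq_norm_sq, inner_sub_left, inner_sub_right,
    real_inner_smul_left, real_inner_smul_right]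
  rw [real_inner_comm a b, real_inner_comm a c, real_inner_comm b c]
  ring

/-- One time step. Here `P` is a Poincaré constant of `D`. With `C P² ≤ 1/2` the divergence part of
the convective term costs at most `α̃_j / 4` of the viscous dissipation; the forcing costs another
`α̃_j / 4`. -/
lemma energy_step [IsFiniteMeasure (vol D)] (hD : IsOpen D) {R : ℝ} (hR : ∀ x ∈ D, ‖x‖ ≤ R)
    {P C : ℝ} (hP : ∀ v : H10 D, ‖val v‖ ≤ P * ‖grad v‖) (hC : C * P ^ 2 ≤ 1 / 2)
    {J : ℕ} {S : FEPair D} {ν : Fin J → E d → ℝ} {f : Fin J → ℝ → HMinus D} {γ μ Δt : ℝ} {M : ℕ}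
    {u : Fin J → ℕ → H10 D} {p : Fin J → ℕ → Lp ℝ 2 (vol D)}
    (hν : ∀ j, MemLp (ν j) ∞ (vol D))
    (hνpos : ∀ j, ∃ c : ℝ, 0 < c ∧ ∀ᵐ x ∂(vol D), c ≤ ν j x)
    (hμ : 1 ≤ μ) (hΔt : 0 < Δt) (hα : ∀ j, 0 < alphaTilde D ν j)
    (hsol : IsBDF2EEVSolution S ν f γ μ Δt M u p) (hstep : TimeStepCondition C ν Δt M u)
    (j : Fin J) {n : ℕ} (hn : 1 ≤ n) (hnM : n + 1 ≤ M) :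
    ‖val (u j (n + 1))‖ ^ 2 + ‖(2 : ℝ) • val (u j (n + 1)) - val (u j n)‖ ^ 2
        + 4 * Δt * ((alphaTilde D ν j / 2 + 3 / 2 * nuPrimeSup D ν j)
          * ‖grad (u j (n + 1))‖ ^ 2)
        + 4 * γ * Δt * ‖dvg (u j (n + 1))‖ ^ 2
      ≤ ‖val (u j n)‖ ^ 2 + ‖(2 : ℝ) • val (u j n) - val (u j (n - 1))‖ ^ 2
        + 4 * Δt * (nuPrimeSup D ν j
          * (‖grad (u j n)‖ ^ 2 + 1 / 2 * ‖grad (u j (n - 1))‖ ^ 2))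
        + 4 * Δt / alphaTilde D ν j * normHMinus (f j (((n + 1 : ℕ) : ℝ) * Δt)) ^ 2 := by
  set v := u j (n + 1)
  set α := alphaTilde D ν j
  set s := nuPrimeSup D ν j
  have hαj : 0 < α := hα j
  have hvX : v ∈ S.Xh := hsol.velocity_mem j n hn hnM
  have hv : EssBounded v := S.essBounded hD hR hvX
  have hmom := hsol.momentum j n hn hnM v hvX
  have hb0 : bStar (ensembleMean u n) v v = 0 := sub_self _
  have hpress : inner ℝ (γ • dvg v - p j (n + 1)) (dvg v) = γ * ‖dvg v‖ ^ 2 := by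
    rw [inner_sub_left, real_inner_smul_left, real_inner_self_eq_norm_sq,
      real_inner_comm, hsol.incompressibility j n hn hnM _ (hsol.pressure_mem j n hn hnM), sub_zero]
  have hnu := le_wGrad_self (memLp_nuBar hν) (nuBarMin_le hνpos) v
  have heddy := le_wGrad_eddyViscosity hμ hΔt u j n hv
  have hfl : |wGrad (nuPrime ν j) (extrap u j n) v| ≤ _ :=
    abs_wGrad_extrapolation_le (norm_nuPrime_le hν j) (u j n) (u j (n - 1)) v
  have hforce : f j (((n + 1 : ℕ) : ℝ) * Δt) v
      ≤ 1 / α * normHMinus (f j (((n + 1 : ℕ) : ℝ) * Δt)) ^ 2 + α / 4 * ‖grad v‖ ^ 2 := by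
    refine ((le_abs_self _).trans (abs_apply_le_normHMinus hP _ v)).trans ?_
    generalize normHMinus (f j (((n + 1 : ℕ) : ℝ) * Δt)) = q
    have h : 1 / α * q ^ 2 + α / 4 * ‖grad v‖ ^ 2 - q * ‖grad v‖
        = 1 / α * (q - α / 2 * ‖grad v‖) ^ 2 := by field_simp; ring
    have : 0 ≤ 1 / α * (q - α / 2 * ‖grad v‖) ^ 2 := by positivity
    linarith
  have hcond := hstep j n hn (by omega)
  have hfin : eLpNorm (dvg (fluct u j n)) ∞ (vol D) ≠ ⊤ := by
    intro h
    rw [h, ENNReal.top_pow two_ne_zero, ENNReal.mul_top (by simpa using hΔt)] at hcond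
    exact absurd hcond (by simp)
  have hB : ∀ᵐ x ∂(vol D), |dvg (fluct u j n) x|
      ≤ (eLpNorm (dvg (fluct u j n)) ∞ (vol D)).toReal :=
    ae_norm_le_of_memLp_top ⟨(Lp.memLp (dvg (fluct u j n))).1, lt_top_iff_ne_top.2 hfin⟩
  set B := (eLpNorm (dvg (fluct u j n)) ∞ (vol D)).toReal
  have hconv := abs_bStar_le hv (fluct u j n) (v - extrap u j n) hΔt hB
  rw [← bStar_eq_bStar_sub hv] at hconv
  -- For `C α < 0` the truncation in `ENNReal.ofReal` makes the condition say `B = 0`.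
  have hBC : Δt * B ^ 2 ≤ C * α ∨ B = 0 := by
    by_cases hCα : 0 ≤ C * α
    · left
      have h := ENNReal.toReal_mono ENNReal.ofReal_ne_top hcond
      rwa [ENNReal.toReal_mul, ENNReal.toReal_pow, ENNReal.toReal_ofReal hΔt.le,
        ENNReal.toReal_ofReal hCα] at h
    · right
      rw [ENNReal.ofReal_of_nonpos (not_le.1 hCα).le] at hcond
      have h : eLpNorm (dvg (fluct u j n)) ∞ (vol D) = 0 := by
        simpa [hΔt.not_ge] using hcond
      simp [B, h]
  have hBv : 1 / 2 * Δt * B ^ 2 * ‖val v‖ ^ 2 ≤ α / 4 * ‖grad v‖ ^ 2 := by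
    have hPv : ‖val v‖ ^ 2 ≤ P ^ 2 * ‖grad v‖ ^ 2 := by
      rw [← mul_pow]
      exact pow_le_pow_left₀ (norm_nonneg _) (hP v) 2
    rcases hBC with h | h
    · calc 1 / 2 * Δt * B ^ 2 * ‖val v‖ ^ 2
          ≤ 1 / 2 * Δt * B ^ 2 * (P ^ 2 * ‖grad v‖ ^ 2) :=
            mul_le_mul_of_nonneg_left hPv (by positivity)
        _ = Δt * B ^ 2 * (1 / 2 * P ^ 2 * ‖grad v‖ ^ 2) := by ring
        _ ≤ C * α * (1 / 2 * P ^ 2 * ‖grad v‖ ^ 2) :=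
            mul_le_mul_of_nonneg_right h (by positivity)
        _ = C * P ^ 2 * (α / 2 * ‖grad v‖ ^ 2) := by ring
        _ ≤ 1 / 2 * (α / 2 * ‖grad v‖ ^ 2) := mul_le_mul_of_nonneg_right hC (by positivity)
        _ = α / 4 * ‖grad v‖ ^ 2 := by ring
    · rw [h]
      have : 0 ≤ α / 4 * ‖grad v‖ ^ 2 := by positivity
      simpa using this
  have hG := bdf2_identity (val v) (val (u j n)) (val (u j (n - 1)))
  have hδ : val (v - extrap u j n)
      = val v - ((2 : ℝ) • val (u j n) - val (u j (n - 1))) := rfl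
  rw [hδ] at hconv
  rw [hb0, hpress] at hmom
  have hαeq : α = nuBarMin D ν - 3 * s := rfl
  have h1 := neg_le_of_abs_le hconv
  have h2 := neg_le_of_abs_le hfl
  have hk : 4 * Δt * (1 / (4 * Δt)) = 1 := by field_simp
  have k1 : 3 / 2 / Δt = 6 * (1 / (4 * Δt)) := by field_simp; norm_num
  have k2 : 2 / Δt = 8 * (1 / (4 * Δt)) := by field_simp; norm_num
  have k3 : 1 / (2 * Δt) = 2 * (1 / (4 * Δt)) := by field_simp; norm_num
  rw [k1, k2, k3] at hmom
  have k4 : 4 * Δt / α = 4 * Δt * (1 / α) := by ring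
  rw [k4]
  -- With `κ = 1 / (4 Δt)` as an atom the balance of all the terms is linear.
  generalize 1 / (4 * Δt) = κ at *
  have hGκ := congrArg (fun t => κ * t) hG
  have hsum : κ * (‖val v‖ ^ 2 + ‖(2 : ℝ) • val v - val (u j n)‖ ^ 2 - ‖val (u j n)‖ ^ 2
        - ‖(2 : ℝ) • val (u j n) - val (u j (n - 1))‖ ^ 2)
      + (α / 2 + 3 / 2 * s) * ‖grad v‖ ^ 2 + γ * ‖dvg v‖ ^ 2
      ≤ s * (‖grad (u j n)‖ ^ 2 + 1 / 2 * ‖grad (u j (n - 1))‖ ^ 2)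
        + 1 / α * normHMinus (f j (((n + 1 : ℕ) : ℝ) * Δt)) ^ 2 := by
    have hm : nuBarMin D ν * ‖grad v‖ ^ 2 = (α + 3 * s) * ‖grad v‖ ^ 2 := by rw [hαeq]; ring
    linarith
  have hfinal := mul_le_mul_of_nonneg_left hsum (by positivity : 0 ≤ 4 * Δt)
  rw [mul_add, mul_add, ← mul_assoc, hk, one_mul] at hfinal
  linarith

/-! ### Summation over the time steps -/

/-- The explicit terms `s a_n + ½ s a_{n-1}` of a step are paid for by the implicit terms
`3/2 s a_n` of the previous two, so that they telescope. -/
lemma telescope_energy {e a b q : ℕ → ℝ} {α s τ γ ρ : ℝ} {M : ℕ} (hM : 1 ≤ M)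
    (h : ∀ n, 1 ≤ n → n + 1 ≤ M →
      e (n + 1) + 4 * τ * ((α / 2 + 3 / 2 * s) * a (n + 1)) + 4 * γ * τ * b (n + 1)
        ≤ e n + 4 * τ * (s * (a n + 1 / 2 * a (n - 1))) + ρ * q (n + 1)) :
    e M + 2 * α * τ * ∑ n ∈ Finset.Icc 2 M, a n
        + 4 * τ * (s * (3 / 2 * a M + 1 / 2 * a (M - 1)))
        + 4 * γ * τ * ∑ n ∈ Finset.Icc 2 M, b n
      ≤ e 1 + 4 * τ * (s * (3 / 2 * a 1 + 1 / 2 * a 0)) + ρ * ∑ n ∈ Finset.Icc 2 M, q n := by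
  induction M, hM using Nat.le_induction with
  | base => simp
  | succ M hM ih =>
    have ih' := ih fun n h1 h2 => h n h1 (h2.trans (Nat.le_succ M))
    have hs := h M hM le_rfl
    rw [Finset.sum_Icc_succ_top (by omega), Finset.sum_Icc_succ_top (by omega),
      Finset.sum_Icc_succ_top (by omega), Nat.add_sub_cancel]
    linarith

end BDF2EEV

theorem mainTheorem3 {d : ℕ} (hd : d = 2 ∨ d = 3) (D : Set (BDF2EEV.E d))
    (hD : BDF2EEV.IsConvexPolytopalDomain D) :
    ∃ C : ℝ, 0 < C ∧
      ∀ (J : ℕ) (S : BDF2EEV.FEPair D) (ν : Fin J → BDF2EEV.E d → ℝ)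
        (f : Fin J → ℝ → BDF2EEV.HMinus D) (γ μ T Δt : ℝ) (M : ℕ)
        (u : Fin J → ℕ → BDF2EEV.H10 D) (p : Fin J → ℕ → Lp ℝ 2 (BDF2EEV.vol D)),
        (∀ j, MemLp (ν j) ∞ (BDF2EEV.vol D)) →
        (∀ j, ∃ c : ℝ, 0 < c ∧ ∀ᵐ x ∂(BDF2EEV.vol D), c ≤ ν j x) →
        0 < γ → 1 ≤ μ → 0 < T → 0 < Δt → (M : ℝ) = T / Δt →
        (∀ j, 0 < BDF2EEV.alphaTilde D ν j) →
        BDF2EEV.IsBDF2EEVSolution S ν f γ μ Δt M u p →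
        BDF2EEV.TimeStepCondition C ν Δt M u →
        ∀ j : Fin J,
          ‖BDF2EEV.val (u j M)‖ ^ 2
              + ‖(2 : ℝ) • BDF2EEV.val (u j M) - BDF2EEV.val (u j (M - 1))‖ ^ 2
              + 2 * BDF2EEV.alphaTilde D ν j * Δt
                  * ∑ n ∈ Finset.Icc 2 M, ‖BDF2EEV.grad (u j n)‖ ^ 2
              + 4 * γ * Δt * ∑ n ∈ Finset.Icc 2 M, ‖BDF2EEV.dvg (u j n)‖ ^ 2
            ≤ ‖BDF2EEV.val (u j 1)‖ ^ 2
              + ‖(2 : ℝ) • BDF2EEV.val (u j 1) - BDF2EEV.val (u j 0)‖ ^ 2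
              + 2 * BDF2EEV.nuBarMin D ν * Δt * ‖BDF2EEV.grad (u j 1)‖ ^ 2
              + 2 * Δt * (BDF2EEV.nuBarMin D ν - 2 * BDF2EEV.nuPrimeSup D ν j)
                  * ‖BDF2EEV.grad (u j 0)‖ ^ 2
              + 4 * Δt / BDF2EEV.alphaTilde D ν j
                  * ∑ n ∈ Finset.Icc 2 M, BDF2EEV.normHMinus (f j ((n : ℝ) * Δt)) ^ 2 := by
  obtain ⟨R, hR0, hR⟩ := hD.exists_norm_le
  have k : Fin d := ⟨0, by omega⟩
  have hfin : IsFiniteMeasure (BDF2EEV.vol D) :=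
    isFiniteMeasure_restrict.2 ((Metric.isBounded_closedBall (x := (0 : BDF2EEV.E d))
      (r := R)).subset (fun x hx => by simpa using hR x hx)).measure_lt_top.ne
  have hP := BDF2EEV.norm_val_le hR0.le hR k
  have hC : 1 / (8 * R ^ 2) * (2 * R) ^ 2 ≤ 1 / 2 := by
    field_simp
    norm_num
  -- The Poincaré constant is `P = 2 R`, and `C = 1 / (2 P²)`.
  refine ⟨1 / (8 * R ^ 2), by positivity, ?_⟩
  intro J S ν f γ μ T Δt M u p hν hνpos hγ hμ hT hΔt hMT hα hsol hstep j
  have hM : 1 ≤ M := by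
    have h : (0 : ℝ) < M := by rw [hMT]; positivity
    exact_mod_cast h
  have key := BDF2EEV.telescope_energy
    (e := fun n => ‖BDF2EEV.val (u j n)‖ ^ 2
      + ‖(2 : ℝ) • BDF2EEV.val (u j n) - BDF2EEV.val (u j (n - 1))‖ ^ 2)
    (a := fun n => ‖BDF2EEV.grad (u j n)‖ ^ 2) (b := fun n => ‖BDF2EEV.dvg (u j n)‖ ^ 2)
    (q := fun n => BDF2EEV.normHMinus (f j ((n : ℝ) * Δt)) ^ 2) hM
    fun n hn hnM => BDF2EEV.energy_step hD.isOpen hR hP hC hν hνpos hμ hΔt hα hsol hstep j hn hnM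
  have hs : 0 ≤ BDF2EEV.nuPrimeSup D ν j := ENNReal.toReal_nonneg
  have hm : 3 * BDF2EEV.nuPrimeSup D ν j ≤ BDF2EEV.nuBarMin D ν := (sub_pos.1 (hα j)).le
  -- The terms left over at the last level are nonnegative; those at the levels `0` and `1` are
  -- majorized by `3 ‖ν'_j‖_∞ ≤ ν̄_min`.
  have hlast : 0 ≤ 4 * Δt * (BDF2EEV.nuPrimeSup D ν j
      * (3 / 2 * ‖BDF2EEV.grad (u j M)‖ ^ 2 + 1 / 2 * ‖BDF2EEV.grad (u j (M - 1))‖ ^ 2)) := by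
    positivity
  have h1 : 2 * Δt * ‖BDF2EEV.grad (u j 1)‖ ^ 2 * (3 * BDF2EEV.nuPrimeSup D ν j)
      ≤ 2 * Δt * ‖BDF2EEV.grad (u j 1)‖ ^ 2 * BDF2EEV.nuBarMin D ν :=
    mul_le_mul_of_nonneg_left hm (by positivity)
  have h0 : 2 * Δt * ‖BDF2EEV.grad (u j 0)‖ ^ 2 * (3 * BDF2EEV.nuPrimeSup D ν j)
      ≤ 2 * Δt * ‖BDF2EEV.grad (u j 0)‖ ^ 2 * BDF2EEV.nuBarMin D ν :=
    mul_le_mul_of_nonneg_left hm (by positivity)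
  simp only [Nat.sub_self] at key
  linarith
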